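/- Let $N\ge 2$, let $C_N^A:=\{x\in\mathbb R^N:\ x_1\ge x_2\ge\dots\ge x_N\}$ be the closed Weyl chamber of type $A_{N-1}$, and let $W_N^A$ be its interior, that is, the set of all $x\in\mathbb R^N$ with $x_1>x_2>\dots>x_N$. For $x\in W_N^A$ let $$H(x):=\Bigl(\sum_{j\ne 1}\frac1{x_1-x_j},\ \dots,\ \sum_{j\ne N}\frac1{x_N-x_j}\Bigr)\in\mathbb R^N .$$ Then for each starting point $x_0\in C_N^A$ (boundary points included) there is a unique continuous function $x:[0,\infty)\to C_N^A$ with $x(0)=x_0$ such that for all $t\in(0,\infty)$ one has $x(t)\in W_N^A$, $x$ is differentiable at $t$, and $\frac{d}{dt}x(t)=H(x(t))$. -/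

import Mathlib

open Set

noncomputable section

/-- The closed Weyl chamber `C_N^A = {x ∈ ℝ^N : x_1 ≥ x_2 ≥ … ≥ x_N}` of type `A_{N-1}`. -/
def closedWeylChamberA (N : ℕ) : Set (EuclideanSpace ℝ (Fin N)) :=
  {x | ∀ i j : Fin N, i ≤ j → x j ≤ x i}

/-- The open Weyl chamber `W_N^A`: the interior of `C_N^A` in `ℝ^N`. -/
def openWeylChamberA (N : ℕ) : Set (EuclideanSpace ℝ (Fin N)) :=
  interior (closedWeylChamberA N)

/-- The vector field `H` with `H_i(x) = ∑_{j ≠ i} 1 / (x_i - x_j)`. -/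
def driftA {N : ℕ} (x : EuclideanSpace ℝ (Fin N)) : EuclideanSpace ℝ (Fin N) :=
  WithLp.toLp 2 fun i => ∑ j ∈ Finset.univ.erase i, 1 / (x i - x j)

/-- `x : [0, ∞) → C_N^A` is continuous, starts in `x₀`, and for all `t > 0` it lies in `W_N^A` and
satisfies `dx/dt = H(x)`. Only the values of `x` on `[0, ∞)` matter. -/
structure IsSolutionA {N : ℕ} (x₀ : EuclideanSpace ℝ (Fin N))
    (x : ℝ → EuclideanSpace ℝ (Fin N)) : Prop where
  continuousOn : ContinuousOn x (Ici 0)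
  mapsTo : MapsTo x (Ici 0) (closedWeylChamberA N)
  initial : x 0 = x₀
  mem_open : ∀ t : ℝ, 0 < t → x t ∈ openWeylChamberA N
  hasDerivAt : ∀ t : ℝ, 0 < t → HasDerivAt x (driftA (x t)) t

end

open Filter Topology NNReal

/-! On the open chamber `H` is the gradient of the concave function `∑_{i<j} log (x_i - x_j)`, so
the distance between two solutions never grows (`dist_le_dist_of_hasDerivAt_driftA`). This gives
uniqueness, even from the boundary, where `H` is singular.

For existence, start inside the chamber with a truncated, globally Lipschitz field. Particles repel:
a minimal gap `δ` opens at speed at least `1 / (N δ)` (`le_driftA_sub_of_minimal_gap`), so a barrier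
argument keeps the truncation inactive and gives gaps of at least `√(t / N)`, whatever the starting
point. A boundary point is a limit of interior ones; by contraction their solutions converge locally
uniformly, and the gap bound passes to the limit. Away from time `0` all gaps are thus bounded
below, `H` is Lipschitz there, and the limit solves the equation. -/

/-! ### Gap regions and the open chamber -/

/-- Configurations whose ordered gaps are all at least `δ`. -/
def gapRegion (N : ℕ) (δ : ℝ) : Set (EuclideanSpace ℝ (Fin N)) :=
  {x | ∀ i j : Fin N, i < j → δ ≤ x i - x j}

theorem gapRegion_anti {N : ℕ} {δ ε : ℝ} (h : δ ≤ ε) : gapRegion N ε ⊆ gapRegion N δ :=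
  fun _ hx i j hij => h.trans (hx i j hij)

theorem isClosed_gapRegion (N : ℕ) (δ : ℝ) : IsClosed (gapRegion N δ) := by
  simp only [gapRegion, ofPred_forall]
  exact isClosed_iInter fun i => isClosed_iInter fun j => isClosed_iInter fun _ =>
    isClosed_le (by fun_prop) (by fun_prop)

theorem mem_openWeylChamberA_iff {N : ℕ} {x : EuclideanSpace ℝ (Fin N)} :
    x ∈ openWeylChamberA N ↔ ∀ i j : Fin N, i < j → x j < x i := by
  constructor
  · intro hx i j hij
    -- Lowering coordinate `i` slightly stays in the closed chamber, which forces a strict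
    -- inequality.
    have hcont : Tendsto (fun ε : ℝ => x - ε • EuclideanSpace.single i (1 : ℝ)) (𝓝[>] 0) (𝓝 x) := by
      have : Continuous (fun ε : ℝ => x - ε • EuclideanSpace.single i (1 : ℝ)) := by fun_prop
      simpa using (this.tendsto 0).mono_left nhdsWithin_le_nhds
    have hmem := hcont.eventually (mem_interior_iff_mem_nhds.1 hx)
    obtain ⟨ε, hε, hpos⟩ := (hmem.and self_mem_nhdsWithin).exists
    have h := hε i j hij.le
    have hpos : 0 < ε := hpos
    simp [hij.ne'] at h
    linarith
  · intro hx
    have hopen : IsOpen {x : EuclideanSpace ℝ (Fin N) | ∀ i j : Fin N, i < j → x j < x i} := by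
      simp only [ofPred_forall]
      exact isOpen_iInter_of_finite fun i => isOpen_iInter_of_finite fun j =>
        isOpen_iInter_of_finite fun _ => isOpen_lt (by fun_prop) (by fun_prop)
    refine interior_maximal (fun y hy i j hij => ?_) hopen hx
    rcases hij.eq_or_lt with rfl | h
    · exact le_rfl
    · exact (hy i j h).le

theorem gapRegion_subset_openWeylChamberA {N : ℕ} {δ : ℝ} (hδ : 0 < δ) :
    gapRegion N δ ⊆ openWeylChamberA N :=
  fun _ hx => mem_openWeylChamberA_iff.2 fun i j hij => by linarith [hx i j hij]

/-- The diagonal term is `1 / 0 = 0`. -/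
theorem driftA_apply {N : ℕ} (x : EuclideanSpace ℝ (Fin N)) (i : Fin N) :
    driftA x i = ∑ j, 1 / (x i - x j) := by
  rw [← Finset.add_sum_erase _ _ (Finset.mem_univ i)]
  simp [driftA]

/-! ### Contraction -/

/-- Symmetrising the double sum in `i` and `j` leaves terms `(a - b) * (1 / a - 1 / b)`, which are
nonpositive because inversion is decreasing. -/
theorem inner_driftA_sub_nonpos {N : ℕ} {x y : EuclideanSpace ℝ (Fin N)}
    (hx : x ∈ openWeylChamberA N) (hy : y ∈ openWeylChamberA N) :
    inner ℝ (x - y) (driftA x - driftA y) ≤ 0 := by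
  rw [mem_openWeylChamberA_iff] at hx hy
  have key : ∀ a b : ℝ, 0 < a → 0 < b → (a - b) * (1 / a - 1 / b) ≤ 0 := by
    intro a b ha hb
    have : (a - b) * (1 / a - 1 / b) = -((a - b) ^ 2 / (a * b)) := by field_simp; ring
    rw [this]
    have : 0 ≤ (a - b) ^ 2 / (a * b) := by positivity
    linarith
  set A : Fin N → Fin N → ℝ := fun i j => 1 / (x i - x j) - 1 / (y i - y j) with hA
  have hanti : ∀ i j, A j i = -A i j := by
    intro i j
    simp only [hA]
    rw [← neg_sub (x i), ← neg_sub (y i), one_div_neg_eq_neg_one_div, one_div_neg_eq_neg_one_div]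
    ring
  have hsum : inner ℝ (x - y) (driftA x - driftA y) = ∑ i, ∑ j, (x i - y i) * A i j := by
    simp only [PiLp.inner_apply, PiLp.sub_apply, driftA_apply, hA,
      ← Finset.sum_sub_distrib, RCLike.inner_apply, conj_trivial]
    exact Finset.sum_congr rfl fun i _ => by rw [mul_comm, Finset.mul_sum]
  have hswap : ∑ i, ∑ j, (x i - y i) * A i j = ∑ i, ∑ j, -((x j - y j) * A i j) := by
    rw [Finset.sum_comm]
    refine Finset.sum_congr rfl fun i _ => Finset.sum_congr rfl fun j _ => ?_
    rw [hanti]; ring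
  have hdouble : 2 * inner ℝ (x - y) (driftA x - driftA y) =
      ∑ i, ∑ j, ((x i - x j) - (y i - y j)) * A i j := by
    rw [two_mul]
    nth_rewrite 2 [hsum]
    rw [hswap, hsum, ← Finset.sum_add_distrib]
    refine Finset.sum_congr rfl fun i _ => ?_
    rw [← Finset.sum_add_distrib]
    exact Finset.sum_congr rfl fun j _ => by ring
  have : ∑ i, ∑ j, ((x i - x j) - (y i - y j)) * A i j ≤ 0 := by
    refine Finset.sum_nonpos fun i _ => Finset.sum_nonpos fun j _ => ?_
    rcases lt_trichotomy i j with h | rfl | h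
    · exact key _ _ (sub_pos.2 (hx i j h)) (sub_pos.2 (hy i j h))
    · simp
    · have := key _ _ (sub_pos.2 (hx j i h)) (sub_pos.2 (hy j i h))
      have e := hanti j i
      simp only [hA] at e ⊢
      rw [e]
      linarith
  linarith

/-- Two solutions in the open chamber do not move apart. -/
theorem dist_le_dist_of_hasDerivAt_driftA {N : ℕ} {x y : ℝ → EuclideanSpace ℝ (Fin N)} {T : ℝ}
    (hxc : ContinuousOn x (Icc 0 T)) (hyc : ContinuousOn y (Icc 0 T))
    (hxm : ∀ t ∈ Ioo 0 T, x t ∈ openWeylChamberA N) (hym : ∀ t ∈ Ioo 0 T, y t ∈ openWeylChamberA N)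
    (hxd : ∀ t ∈ Ioo 0 T, HasDerivAt x (driftA (x t)) t)
    (hyd : ∀ t ∈ Ioo 0 T, HasDerivAt y (driftA (y t)) t) {t : ℝ} (ht : t ∈ Icc 0 T) :
    dist (x t) (y t) ≤ dist (x 0) (y 0) := by
  have hd : ∀ s ∈ Ioo 0 T, HasDerivAt (fun s => ‖x s - y s‖ ^ 2)
      (2 * inner ℝ (x s - y s) (driftA (x s) - driftA (y s))) s :=
    fun s hs => ((hxd s hs).sub (hyd s hs)).norm_sq
  have hanti : AntitoneOn (fun s => ‖x s - y s‖ ^ 2) (Icc 0 T) := by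
    refine antitoneOn_of_deriv_nonpos (convex_Icc 0 T) ((hxc.sub hyc).norm.pow 2) ?_ ?_
    · rw [interior_Icc]
      exact fun s hs => (hd s hs).differentiableAt.differentiableWithinAt
    · rw [interior_Icc]
      intro s hs
      rw [(hd s hs).deriv]
      linarith [inner_driftA_sub_nonpos (hxm s hs) (hym s hs)]
  have := hanti ⟨le_rfl, ht.1.trans ht.2⟩ ht ht.1
  rw [dist_eq_norm, dist_eq_norm]
  exact (sq_le_sq₀ (norm_nonneg _) (norm_nonneg _)).1 this

/-! ### Barrier principle -/

/-- A finite family of continuous functions starting positive stays positive if at every time where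
all are nonnegative, those that vanish have positive derivative. -/
theorem pos_of_hasDerivAt_pos_of_eq_zero {ι : Type*} [Finite ι] {p : ι → ℝ → ℝ} {T : ℝ}
    (hc : ∀ k, ContinuousOn (p k) (Icc 0 T)) (h0 : ∀ k, 0 < p k 0)
    (hd : ∀ t ∈ Ioo 0 T, (∀ l, 0 ≤ p l t) → ∀ k, p k t = 0 → ∃ d > 0, HasDerivAt (p k) d t)
    {t : ℝ} (ht : t ∈ Ico 0 T) (k : ι) : 0 < p k t := by
  by_contra hneg
  -- The infimum of `B` is the first time at which some member fails to be positive.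
  set B : Set ℝ := ⋃ l, Icc 0 t ∩ p l ⁻¹' Iic 0 with hB
  have hcl : IsClosed B := isClosed_iUnion_of_finite fun l =>
    ((hc l).mono (Icc_subset_Icc_right ht.2.le)).preimage_isClosed_of_isClosed isClosed_Icc
      isClosed_Iic
  have hne : B.Nonempty := ⟨t, mem_iUnion.2 ⟨k, ⟨ht.1, le_rfl⟩, not_lt.1 hneg⟩⟩
  have hbdd : BddBelow B := ⟨0, fun s hs => by obtain ⟨l, hl, _⟩ := mem_iUnion.1 hs; exact hl.1⟩
  obtain ⟨l, hsI, hl⟩ := mem_iUnion.1 (hcl.csInf_mem hne hbdd)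
  set s := sInf B
  have hl : p l s ≤ 0 := hl
  have hs0 : 0 < s := hsI.1.lt_of_ne fun h => by rw [← h] at hl; exact (h0 l).not_ge hl
  have hsT : s ∈ Ioo 0 T := ⟨hs0, hsI.2.trans_lt ht.2⟩
  have hbefore : ∀ r ∈ Ico 0 s, ∀ m, 0 < p m r := by
    intro r hr m
    by_contra hm
    exact (csInf_le hbdd (mem_iUnion.2 ⟨m, ⟨hr.1, hr.2.le.trans hsI.2⟩, not_lt.1 hm⟩)).not_gt hr.2
  have hev : ∀ᶠ r in 𝓝[<] s, r ∈ Ico 0 s := Ico_mem_nhdsLT hs0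
  have hnn : ∀ m, 0 ≤ p m s := by
    intro m
    have hat : ContinuousAt (p m) s := (hc m).continuousAt (Icc_mem_nhds hsT.1 hsT.2)
    exact ge_of_tendsto (hat.tendsto.mono_left nhdsWithin_le_nhds)
      (hev.mono fun r hr => (hbefore r hr m).le)
  have hls : p l s = 0 := le_antisymm hl (hnn l)
  obtain ⟨d, hdpos, hder⟩ := hd s hsT hnn l hls
  -- Before `s` the function is positive, at `s` it vanishes, so left difference quotients are
  -- nonpositive, against `d > 0`.
  have hslope := (hasDerivAt_iff_tendsto_slope.1 hder).mono_left
    (nhdsWithin_mono s (fun r (hr : r < s) => hr.ne) : 𝓝[<] s ≤ 𝓝[≠] s)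
  refine hdpos.not_ge (le_of_tendsto hslope (hev.mono fun r hr => ?_))
  rw [slope_def_field, hls, sub_zero]
  exact div_nonpos_of_nonneg_of_nonpos (hbefore r hr l).le (by linarith [hr.2])

/-! ### Truncated drift -/

/-- A bounded Lipschitz vector field has a solution on `[0, T]` from every starting point. -/
theorem exists_hasDerivWithinAt_of_lipschitzWith_of_bounded {E : Type*} [NormedAddCommGroup E]
    [NormedSpace ℝ E] [CompleteSpace E] {F : E → E} {K L : ℝ≥0} (hF : LipschitzWith K F)
    (hL : ∀ x, ‖F x‖ ≤ L) {T : ℝ} (hT : 0 ≤ T) (x₀ : E) :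
    ∃ α : ℝ → E, α 0 = x₀ ∧ ∀ t ∈ Icc 0 T, HasDerivWithinAt α (F (α t)) (Icc 0 T) t := by
  -- At speed at most `L` no curve leaves the ball of radius `L * T` by time `T`, so one application
  -- covers the whole interval.
  have h : IsPicardLindelof (fun _ => F) (⟨0, le_rfl, hT⟩ : Icc 0 T) x₀ (L * ⟨T, hT⟩) 0 L K :=
    { lipschitzOnWith := fun _ _ => hF.lipschitzOnWith
      continuousOn := fun _ _ => continuousOn_const
      norm_le := fun _ _ x _ => hL x
      mul_max_le := by simp [hT]; rfl }
  exact h.exists_eq_forall_mem_Icc_hasDerivWithinAt₀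

theorem abs_one_div_max_sub_le {δ : ℝ} (hδ : 0 < δ) (a b : ℝ) :
    |1 / max a δ - 1 / max b δ| ≤ (1 / δ ^ 2) * |a - b| := by
  have ha : δ ≤ max a δ := le_max_right _ _
  have hb : δ ≤ max b δ := le_max_right _ _
  have ha' : 0 < max a δ := hδ.trans_le ha
  have hb' : 0 < max b δ := hδ.trans_le hb
  have hm : |max b δ - max a δ| ≤ |a - b| := by
    rw [abs_sub_comm a b]
    exact abs_max_sub_max_le_abs b a δ
  have e : 1 / max a δ - 1 / max b δ = (1 / (max a δ * max b δ)) * (max b δ - max a δ) := by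
    field_simp
  rw [e, abs_mul, abs_of_nonneg (by positivity)]
  have hprod : δ ^ 2 ≤ max a δ * max b δ := by nlinarith
  gcongr

/-- The interaction `1 / (x i - x j)` with gaps truncated below at `δ`. -/
noncomputable def truncInteraction {N : ℕ} (δ : ℝ) (i j : Fin N) (r : ℝ) : ℝ :=
  if i < j then 1 / max r δ else if j < i then -(1 / max (-r) δ) else 0

theorem abs_truncInteraction_sub_le {N : ℕ} {δ : ℝ} (hδ : 0 < δ) (i j : Fin N) (r s : ℝ) :
    |truncInteraction δ i j r - truncInteraction δ i j s| ≤ (1 / δ ^ 2) * |r - s| := by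
  unfold truncInteraction
  split_ifs
  · exact abs_one_div_max_sub_le hδ r s
  · have := abs_one_div_max_sub_le hδ (-s) (-r)
    rwa [show -s - -r = r - s by ring, ← neg_sub_neg] at this
  · simp; positivity

theorem abs_truncInteraction_le {N : ℕ} {δ : ℝ} (hδ : 0 < δ) (i j : Fin N) (r : ℝ) :
    |truncInteraction δ i j r| ≤ 1 / δ := by
  have key : ∀ a : ℝ, |1 / max a δ| ≤ 1 / δ := fun a => by
    have : δ ≤ max a δ := le_max_right _ _
    rw [abs_of_nonneg (by positivity)]
    gcongr
  unfold truncInteraction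
  split_ifs
  · exact key r
  · rw [abs_neg]; exact key _
  · simp; positivity

/-- A bounded Lipschitz vector field that agrees with `driftA` on `gapRegion N δ`. -/
noncomputable def truncDriftA {N : ℕ} (δ : ℝ) (x : EuclideanSpace ℝ (Fin N)) : EuclideanSpace ℝ (Fin N) :=
  WithLp.toLp 2 fun i => ∑ j, truncInteraction δ i j (x i - x j)

theorem truncDriftA_eq_driftA {N : ℕ} {δ : ℝ} {x : EuclideanSpace ℝ (Fin N)}
    (hx : x ∈ gapRegion N δ) : truncDriftA δ x = driftA x := by
  ext i
  rw [driftA_apply]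
  change ∑ j, truncInteraction δ i j (x i - x j) = _
  refine Finset.sum_congr rfl fun j _ => ?_
  unfold truncInteraction
  split_ifs with h h'
  · rw [max_eq_left (hx i j h)]
  · rw [neg_sub, max_eq_left (hx j i h'), ← neg_sub (x i), one_div_neg_eq_neg_one_div, neg_neg]
  · rw [le_antisymm (not_lt.1 h') (not_lt.1 h)]
    simp

theorem exists_lipschitzWith_truncDriftA (N : ℕ) {δ : ℝ} (hδ : 0 < δ) :
    ∃ K, LipschitzWith K (truncDriftA (N := N) δ) := by
  have hpi : LipschitzWith (N * (1 / δ ^ 2 * 2)).toNNReal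
      fun (x : EuclideanSpace ℝ (Fin N)) i => ∑ j, truncInteraction δ i j (x i - x j) := by
    refine LipschitzWith.of_dist_le' fun x y => ?_
    rw [dist_pi_le_iff (by positivity)]
    intro i
    rw [Real.dist_eq, ← Finset.sum_sub_distrib]
    refine (Finset.abs_sum_le_sum_abs _ _).trans ?_
    have hterm : ∀ j ∈ Finset.univ, |truncInteraction δ i j (x i - x j) -
        truncInteraction δ i j (y i - y j)| ≤ 1 / δ ^ 2 * 2 * dist x y := by
      intro j _
      refine (abs_truncInteraction_sub_le hδ i j _ _).trans ?_
      rw [mul_assoc]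
      gcongr
      have hi := PiLp.norm_apply_le (x - y) i
      have hj := PiLp.norm_apply_le (x - y) j
      rw [← dist_eq_norm, PiLp.sub_apply, Real.norm_eq_abs] at hi hj
      rw [show x i - x j - (y i - y j) = (x i - y i) - (x j - y j) by ring]
      linarith [abs_sub (x i - y i) (x j - y j)]
    refine (Finset.sum_le_card_nsmul _ _ _ hterm).trans (le_of_eq ?_)
    simp only [Finset.card_univ, Fintype.card_fin, nsmul_eq_mul]
    ring
  exact ⟨_, (PiLp.lipschitzWith_toLp 2 fun _ : Fin N => ℝ).comp hpi⟩

theorem exists_norm_truncDriftA_le (N : ℕ) {δ : ℝ} (hδ : 0 < δ) :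
    ∃ L : ℝ≥0, ∀ x, ‖truncDriftA (N := N) δ x‖ ≤ L := by
  refine ⟨Real.toNNReal (√(∑ _ : Fin N, (N * (1 / δ)) ^ 2)), fun x => ?_⟩
  rw [Real.coe_toNNReal _ (Real.sqrt_nonneg _), EuclideanSpace.norm_eq]
  refine Real.sqrt_le_sqrt (Finset.sum_le_sum fun i _ => ?_)
  change |∑ j, truncInteraction δ i j (x i - x j)| ^ 2 ≤ _
  refine pow_le_pow_left₀ (abs_nonneg _) ((Finset.abs_sum_le_sum_abs _ _).trans ?_) 2
  refine (Finset.sum_le_card_nsmul _ _ _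
    fun j _ => abs_truncInteraction_le hδ i j _).trans (le_of_eq ?_)
  simp

/-! ### Opening of a minimal gap -/

theorem mul_le_sub_of_mem_gapRegion {N : ℕ} {δ : ℝ} {x : EuclideanSpace ℝ (Fin N)}
    (hx : x ∈ gapRegion N δ) {i j : Fin N} (hij : i ≤ j) :
    ((j : ℝ) - i) * δ ≤ x i - x j := by
  obtain ⟨n, hn⟩ := Nat.exists_eq_add_of_le (Fin.le_def.1 hij)
  induction n generalizing j with
  | zero =>
    obtain rfl : j = i := Fin.ext (by simpa using hn)
    simp
  | succ n ih =>
    have hlt : i.val + n < N := by omega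
    have h1 := @ih ⟨i + n, hlt⟩ (Fin.le_def.2 (by simp)) rfl
    have h2 := hx ⟨i + n, hlt⟩ j (Fin.lt_def.2 (by simp; omega))
    rw [hn]
    push_cast at h1 ⊢
    linarith

/-- Equality holds at `u = m * δ`: equal spacing is the worst case for the opening of a gap. -/
theorem one_div_sub_one_div_add_le {δ u m : ℝ} (hδ : 0 < δ) (hm : 0 < m) (hu : m * δ ≤ u) :
    1 / u - 1 / (u + δ) ≤ 1 / δ * (1 / m - 1 / (m + 1)) := by
  have hu0 : 0 < u := lt_of_lt_of_le (by positivity) hu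
  have e1 : 1 / u - 1 / (u + δ) = δ / (u * (u + δ)) := by field_simp; ring
  have e2 : 1 / δ * (1 / m - 1 / (m + 1)) = δ / ((m * δ) * (m * δ + δ)) := by field_simp; ring
  rw [e1, e2]
  gcongr

/-- If a gap of size `δ` is minimal, the drift opens it at speed at least `1 / (N δ)`. -/
theorem le_driftA_sub_of_minimal_gap {N : ℕ} {δ : ℝ} (hδ : 0 < δ) {x : EuclideanSpace ℝ (Fin N)}
    (hx : x ∈ gapRegion N δ) {i j : Fin N} (hij : i < j) (hgap : x i - x j = δ) :
    1 / (N * δ) ≤ driftA x i - driftA x j := by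
  -- Were there a particle in between, the gap would be at least `2 * δ`.
  have hj : (j : ℕ) = i + 1 := by
    have h := mul_le_sub_of_mem_gapRegion hx hij.le
    rw [hgap] at h
    have h' : (j : ℝ) - i ≤ 1 := by
      by_contra hc
      nlinarith
    have h'' : (j : ℝ) ≤ i + 1 := by linarith
    have : (j : ℕ) ≤ i + 1 := by exact_mod_cast h''
    have := Fin.lt_def.1 hij
    omega
  have hjr : (j : ℝ) = i + 1 := by rw [hj]; push_cast; rfl
  -- For equal spacing `δ` the two interactions with particle `k` are `f (k + 1) / δ` and `f k / δ`,
  -- so their differences telescope. The convention `f (i + 1) = 1 / 0 = 0` matches the missing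
  -- self-interactions.
  set f : ℕ → ℝ := fun k => 1 / ((k : ℝ) - i - 1) with hf
  have hterm : ∀ k : Fin N, 1 / δ * (f (k + 1) - f k) ≤ 1 / (x i - x k) - 1 / (x j - x k) := by
    intro k
    have hfk : f (k + 1) = 1 / ((k : ℝ) - i) := by
      simp only [hf]; push_cast; ring_nf
    rw [hfk]
    rcases lt_trichotomy k i with h | rfl | h
    · have hr : (0 : ℝ) < i - k := by
        have : (k : ℝ) < i := by exact_mod_cast Fin.lt_def.1 h
        linarith
      have := one_div_sub_one_div_add_le hδ hr (mul_le_sub_of_mem_gapRegion hx h.le)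
      rw [show x k - x i + δ = -(x j - x k) by linarith, ← neg_sub (x i) (x k),
        one_div_neg_eq_neg_one_div, one_div_neg_eq_neg_one_div] at this
      simp only [hf]
      rw [← neg_sub (i : ℝ) k, one_div_neg_eq_neg_one_div,
        show (-((i : ℝ) - k) - 1) = -((i : ℝ) - k + 1) by ring, one_div_neg_eq_neg_one_div]
      linarith
    · simp only [hf]
      rw [← neg_sub (x k) (x j), hgap, one_div_neg_eq_neg_one_div]
      simp
    · rcases (show k = j ∨ j < k by
        rw [Fin.lt_def] at h ⊢
        rw [Fin.ext_iff]
        omega) with rfl | h'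
      · simp [hf, hgap, hjr]
      · have hr : (0 : ℝ) < k - j := by
          have : (j : ℝ) < k := by exact_mod_cast Fin.lt_def.1 h'
          linarith
        have := one_div_sub_one_div_add_le hδ hr (mul_le_sub_of_mem_gapRegion hx h'.le)
        rw [show x j - x k + δ = x i - x k by linarith, hjr,
          show (k : ℝ) - (i + 1) + 1 = k - i by ring, show (k : ℝ) - (i + 1) = k - i - 1 by ring]
          at this
        simp only [hf]
        linarith
  have htel : ∑ k : Fin N, 1 / δ * (f (k + 1) - f k) = 1 / δ * (f N - f 0) := by
    rw [← Finset.mul_sum, Fin.sum_univ_eq_sum_range (fun k => f (k + 1) - f k),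
      Finset.sum_range_sub]
  have hN : (i : ℝ) + 1 ≤ N := by exact_mod_cast i.isLt
  have hfN : 0 ≤ f N := one_div_nonneg.2 (by linarith)
  have hf0 : -f 0 = 1 / ((i : ℝ) + 1) := by
    simp only [hf]
    rw [show ((0 : ℕ) : ℝ) - i - 1 = -((i : ℝ) + 1) by push_cast; ring,
      one_div_neg_eq_neg_one_div, neg_neg]
  have hle : 1 / (N : ℝ) ≤ 1 / ((i : ℝ) + 1) := by gcongr
  calc 1 / (N * δ) = 1 / δ * (1 / N) := by rw [mul_comm, one_div_mul_one_div]
    _ ≤ 1 / δ * (f N - f 0) := by gcongr; linarith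
    _ ≤ driftA x i - driftA x j := by
      rw [← htel, driftA_apply, driftA_apply, ← Finset.sum_sub_distrib]
      exact Finset.sum_le_sum fun k _ => hterm k

/-! ### Solutions from the open chamber -/

/-- From a starting point in the open chamber there is a solution on any bounded time interval,
and its gaps at time `t` are at least `√(t / N)`. -/
theorem exists_solution_of_mem_gapRegion {N : ℕ} {ε : ℝ} (hε : 0 < ε)
    {x₀ : EuclideanSpace ℝ (Fin N)} (hx₀ : x₀ ∈ gapRegion N ε) {T : ℝ} (hT : 0 ≤ T) :
    ∃ α : ℝ → EuclideanSpace ℝ (Fin N), α 0 = x₀ ∧ ContinuousOn α (Icc 0 T) ∧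
      ∀ t ∈ Ioo 0 T, α t ∈ gapRegion N √(t / N) ∧ α t ∈ openWeylChamberA N ∧
        HasDerivAt α (driftA (α t)) t := by
  have hε2 : 0 < ε / 2 := by positivity
  obtain ⟨K, hK⟩ := exists_lipschitzWith_truncDriftA N hε2
  obtain ⟨L, hL⟩ := exists_norm_truncDriftA_le N hε2
  obtain ⟨α, hα0, hα⟩ := exists_hasDerivWithinAt_of_lipschitzWith_of_bounded hK hL hT x₀
  have hc : ContinuousOn α (Icc 0 T) := fun t ht => (hα t ht).continuousWithinAt
  have hd : ∀ t ∈ Ioo 0 T, HasDerivAt α (truncDriftA (ε / 2) (α t)) t := fun t ht =>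
    (hα t (Ioo_subset_Icc_self ht)).hasDerivAt (Icc_mem_nhds ht.1 ht.2)
  have hcoord : ∀ t ∈ Ioo 0 T, ∀ i, HasDerivAt (fun s => α s i) (truncDriftA (ε / 2) (α t) i) t :=
    fun t ht i => (EuclideanSpace.proj (𝕜 := ℝ) i).hasFDerivAt.comp_hasDerivAt t (hd t ht)
  -- This barrier has speed `1 / (2 N w)`, half of what a minimal gap `w` guarantees, so the
  -- comparison is strict. It starts at `ε / 2 < ε` and never drops below the truncation level.
  set w : ℝ → ℝ := fun t => √((ε / 2) ^ 2 + t / N) with hw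
  have hwε : ∀ t, 0 ≤ t → ε / 2 ≤ w t := fun t ht =>
    Real.le_sqrt_of_sq_le (le_add_of_nonneg_right (by positivity))
  have hbarrier : ∀ t ∈ Ico 0 T, ∀ k : {k : Fin N × Fin N // k.1 < k.2},
      0 < α t k.1.1 - α t k.1.2 - w t := by
    intro t ht k
    refine pos_of_hasDerivAt_pos_of_eq_zero
      (p := fun (k : {k : Fin N × Fin N // k.1 < k.2}) t => α t k.1.1 - α t k.1.2 - w t)
      (fun k => ?_) (fun k => ?_) (fun s hs hnn k hk => ?_) ht k
    · have := fun i => (EuclideanSpace.proj (𝕜 := ℝ) i).continuous.comp_continuousOn hc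
      exact ((this k.1.1).sub (this k.1.2)).sub (by fun_prop)
    · have := hx₀ k.1.1 k.1.2 k.2
      simp only [hw, hα0, zero_div, add_zero, Real.sqrt_sq hε2.le]
      linarith
    · have hN : (0 : ℝ) < N := by exact_mod_cast k.1.1.pos
      have hwpos : 0 < w s := hε2.trans_le (hwε s hs.1.le)
      have hgap : α s ∈ gapRegion N (w s) := fun i j hij => sub_nonneg.1 (hnn ⟨(i, j), hij⟩)
      have heq := truncDriftA_eq_driftA (gapRegion_anti (hwε s hs.1.le) hgap)
      have hopen := le_driftA_sub_of_minimal_gap hwpos hgap k.2 (sub_eq_zero.1 hk)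
      have hwd : HasDerivAt w ((1 / N) / (2 * w s)) s :=
        (((hasDerivAt_id s).div_const (N : ℝ)).const_add _).sqrt
          (Real.sqrt_ne_zero'.1 hwpos.ne' |>.ne')
      refine ⟨_, ?_, ((hcoord s hs k.1.1).sub (hcoord s hs k.1.2)).sub hwd⟩
      rw [heq]
      have hpos : 0 < 1 / (N * w s) := by positivity
      have e : (1 / N) / (2 * w s) = 1 / (N * w s) / 2 := by field_simp
      linarith
  refine ⟨α, hα0, hc, fun t ht => ?_⟩
  have hgap : α t ∈ gapRegion N (w t) := fun i j hij =>
    (sub_pos.1 (hbarrier t (Ioo_subset_Ico_self ht) ⟨(i, j), hij⟩)).le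
  have hwt := hwε t ht.1.le
  refine ⟨gapRegion_anti (Real.sqrt_le_sqrt (le_add_of_nonneg_left (by positivity))) hgap,
    gapRegion_subset_openWeylChamberA (hε2.trans_le hwt) hgap, ?_⟩
  rw [← truncDriftA_eq_driftA (gapRegion_anti hwt hgap)]
  exact hd t ht

/-! ### Uniqueness, and existence from the closed chamber -/

theorem IsSolutionA.eqOn {N : ℕ} {x₀ : EuclideanSpace ℝ (Fin N)}
    {x y : ℝ → EuclideanSpace ℝ (Fin N)} (hx : IsSolutionA x₀ x) (hy : IsSolutionA x₀ y) :
    EqOn x y (Ici 0) := by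
  intro t ht
  have h := dist_le_dist_of_hasDerivAt_driftA (T := t) (hx.continuousOn.mono Icc_subset_Ici_self)
    (hy.continuousOn.mono Icc_subset_Ici_self) (fun s hs => hx.mem_open s hs.1)
    (fun s hs => hy.mem_open s hs.1) (fun s hs => hx.hasDerivAt s hs.1)
    (fun s hs => hy.hasDerivAt s hs.1) ⟨ht, le_rfl⟩
  rw [hx.initial, hy.initial, dist_self] at h
  exact dist_le_zero.1 h

/-- Every point of the closed chamber is a limit of points with distinct coordinates. -/
theorem exists_seq_gapRegion_tendsto {N : ℕ} {x₀ : EuclideanSpace ℝ (Fin N)}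
    (hx₀ : x₀ ∈ closedWeylChamberA N) : ∃ z : ℕ → EuclideanSpace ℝ (Fin N),
      (∀ n, ∃ ε > 0, z n ∈ gapRegion N ε) ∧ Tendsto z atTop (𝓝 x₀) := by
  set ρ : EuclideanSpace ℝ (Fin N) := WithLp.toLp 2 fun i => -(i : ℝ) with hρ
  refine ⟨fun n => x₀ + (1 / ((n : ℝ) + 1)) • ρ, fun n => ⟨1 / ((n : ℝ) + 1), by positivity, ?_⟩, ?_⟩
  · intro i j hij
    have h1 := hx₀ i j hij.le
    have h2 : (i : ℝ) + 1 ≤ j := by exact_mod_cast Fin.lt_def.1 hij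
    have h3 : 0 < 1 / ((n : ℝ) + 1) := by positivity
    simp only [hρ, PiLp.add_apply, PiLp.smul_apply, smul_eq_mul]
    nlinarith
  · simpa using ((tendsto_one_div_add_atTop_nhds_zero_nat (𝕜 := ℝ)).smul_const ρ).const_add x₀

theorem exists_isSolutionA {N : ℕ} {x₀ : EuclideanSpace ℝ (Fin N)}
    (hx₀ : x₀ ∈ closedWeylChamberA N) : ∃ x, IsSolutionA x₀ x := by
  obtain ⟨z, hz, hzlim⟩ := exists_seq_gapRegion_tendsto hx₀
  choose ε hε hzε using hz
  choose α hα0 hαc hα using fun n : ℕ =>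
    exists_solution_of_mem_gapRegion (hε n) (hzε n) (Nat.cast_nonneg n : (0 : ℝ) ≤ n)
  have hdist : ∀ m n : ℕ, ∀ t : ℝ, 0 ≤ t → t ≤ m → t ≤ n →
      dist (α m t) (α n t) ≤ dist (z m) (z n) := by
    intro m n t ht hm hn
    rw [← hα0 m, ← hα0 n]
    exact dist_le_dist_of_hasDerivAt_driftA (T := t)
      ((hαc m).mono (Icc_subset_Icc_right hm)) ((hαc n).mono (Icc_subset_Icc_right hn))
      (fun s hs => (hα m s ⟨hs.1, hs.2.trans_le hm⟩).2.1)
      (fun s hs => (hα n s ⟨hs.1, hs.2.trans_le hn⟩).2.1)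
      (fun s hs => (hα m s ⟨hs.1, hs.2.trans_le hm⟩).2.2)
      (fun s hs => (hα n s ⟨hs.1, hs.2.trans_le hn⟩).2.2) ⟨ht, le_rfl⟩
  -- `α n` is controlled only up to time `n`, so only indices beyond `t` count. Negative times get a
  -- dummy value.
  have hcauchy : ∀ t : ℝ, ∃ y, 0 ≤ t → Tendsto (fun n => α n t) atTop (𝓝 y) := by
    intro t
    by_cases ht : 0 ≤ t
    · have : CauchySeq fun n => α n t := by
        rw [Metric.cauchySeq_iff]
        intro η hη
        obtain ⟨M, hM⟩ := Metric.cauchySeq_iff.1 hzlim.cauchySeq η hη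
        obtain ⟨M', hM'⟩ := exists_nat_ge t
        refine ⟨max M M', fun m hm n hn => (hdist m n t ht ?_ ?_).trans_lt
          (hM m (le_of_max_le_left hm) n (le_of_max_le_left hn))⟩
        · exact hM'.trans (by exact_mod_cast le_of_max_le_right hm)
        · exact hM'.trans (by exact_mod_cast le_of_max_le_right hn)
      obtain ⟨y, hy⟩ := cauchySeq_tendsto_of_complete this
      exact ⟨y, fun _ => hy⟩
    · exact ⟨0, fun h => absurd h ht⟩
  choose x hx using hcauchy
  have hle : ∀ n : ℕ, ∀ t : ℝ, 0 ≤ t → t ≤ n → dist (x t) (α n t) ≤ dist x₀ (z n) := by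
    intro n t ht hn
    refine le_of_tendsto_of_tendsto ((hx t ht).dist tendsto_const_nhds)
      (hzlim.dist tendsto_const_nhds) ?_
    obtain ⟨M, hM⟩ := exists_nat_ge t
    filter_upwards [eventually_ge_atTop M] with m hm
    exact hdist m n t ht (hM.trans (by exact_mod_cast hm)) hn
  have hunif : ∀ T : ℝ, TendstoUniformlyOn α x atTop (Icc 0 T) := by
    intro T
    rw [Metric.tendstoUniformlyOn_iff]
    intro η hη
    have hz0 : Tendsto (fun n => dist x₀ (z n)) atTop (𝓝 0) := by
      simpa using (tendsto_const_nhds (x := x₀)).dist hzlim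
    obtain ⟨M, hM⟩ := exists_nat_ge T
    filter_upwards [eventually_ge_atTop M, hz0.eventually_lt_const hη] with n hn hlt t ht
    exact (hle n t ht.1 (ht.2.trans (hM.trans (by exact_mod_cast hn)))).trans_lt hlt
  have hcont : ∀ T : ℝ, ContinuousOn x (Icc 0 T) := by
    intro T
    refine (hunif T).continuousOn (Eventually.frequently ?_)
    obtain ⟨M, hM⟩ := exists_nat_ge T
    filter_upwards [eventually_ge_atTop M] with n hn
    exact (hαc n).mono (Icc_subset_Icc_right (hM.trans (by exact_mod_cast hn)))
  have hevent : ∀ T : ℝ, ∀ᶠ n : ℕ in atTop, ∀ t ∈ Ioo 0 T, α n t ∈ gapRegion N √(t / N) ∧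
      HasDerivAt (α n) (driftA (α n t)) t := by
    intro T
    obtain ⟨M, hM⟩ := exists_nat_ge T
    filter_upwards [eventually_ge_atTop M] with n hn t ht
    have := hα n t ⟨ht.1, ht.2.trans_le (hM.trans (by exact_mod_cast hn))⟩
    exact ⟨this.1, this.2.2⟩
  have hgap : ∀ t, 0 < t → x t ∈ gapRegion N √(t / N) := fun t ht =>
    (isClosed_gapRegion N _).mem_of_tendsto (hx t ht.le)
      ((hevent (t + 1)).mono fun n hn => (hn t ⟨ht, by linarith⟩).1)
  have hinit : x 0 = x₀ := by
    refine tendsto_nhds_unique (hx 0 le_rfl) ?_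
    simpa only [hα0] using hzlim
  have hopen : ∀ t, 0 < t → x t ∈ openWeylChamberA N := by
    intro t ht
    rw [mem_openWeylChamberA_iff]
    intro i j hij
    have hN : (0 : ℝ) < N := by exact_mod_cast i.pos
    have := hgap t ht i j hij
    have : 0 < √(t / N) := Real.sqrt_pos.2 (by positivity)
    linarith
  refine ⟨x, ?_, ?_, hinit, hopen, ?_⟩
  · intro t ht
    refine ((hcont (t + 1)) t ⟨ht, by linarith⟩).mono_of_mem_nhdsWithin ?_
    rw [← Ici_inter_Iic]
    exact inter_mem_nhdsWithin _ (Iic_mem_nhds (by linarith))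
  · intro t ht
    rcases (show (0 : ℝ) ≤ t from ht).eq_or_lt with rfl | h
    · rw [hinit]; exact hx₀
    · exact interior_subset (hopen t h)
  · intro t ht
    -- For `N = 0` the bound `√(t / N)` degenerates to `0`, but the space is a single point.
    rcases N.eq_zero_or_pos with rfl | hNpos
    · have hconst : x = fun _ => x t := funext fun s => Subsingleton.elim _ _
      rw [Subsingleton.elim (driftA (x t)) 0, hconst]
      exact hasDerivAt_const _ _
    have hN : (0 : ℝ) < N := by exact_mod_cast hNpos
    -- The gap bound at time `t / 2` serves all later times, so near `t` one truncated field drives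
    -- the limit and almost all `α n`; its uniform continuity makes the derivatives converge
    -- uniformly.
    set δ := √(t / 2 / N) with hδ
    have hδpos : 0 < δ := Real.sqrt_pos.2 (by positivity)
    have hsub : ∀ s ∈ Ioo (t / 2) (t + 1), gapRegion N √(s / N) ⊆ gapRegion N δ := fun s hs =>
      gapRegion_anti (Real.sqrt_le_sqrt (by have := hs.1; gcongr))
    obtain ⟨K, hK⟩ := exists_lipschitzWith_truncDriftA N hδpos
    have hmem : t ∈ Ioo (t / 2) (t + 1) := ⟨by linarith, by linarith⟩
    have hpos : ∀ s ∈ Ioo (t / 2) (t + 1), 0 < s := fun s hs => by linarith [hs.1]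
    have hU : TendstoUniformlyOn (fun n s => truncDriftA δ (α n s)) (fun s => truncDriftA δ (x s))
        atTop (Ioo (t / 2) (t + 1)) :=
      hK.uniformContinuous.comp_tendstoUniformlyOn
        ((hunif (t + 1)).mono fun s hs => ⟨(hpos s hs).le, hs.2.le⟩)
    rw [← truncDriftA_eq_driftA (hsub t hmem (hgap t ht))]
    refine hasDerivAt_of_tendstoUniformlyOn isOpen_Ioo hU ?_ (fun s hs => hx s (hpos s hs).le) hmem
    filter_upwards [hevent (t + 1)] with n hn s hs
    obtain ⟨h1, h2⟩ := hn s ⟨hpos s hs, hs.2⟩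
    rwa [truncDriftA_eq_driftA (hsub s hs h1)]

theorem mainTheorem1 (N : ℕ) (hN : 2 ≤ N) (x₀ : EuclideanSpace ℝ (Fin N))
    (hx₀ : x₀ ∈ closedWeylChamberA N) :
    ∃ x : ℝ → EuclideanSpace ℝ (Fin N), IsSolutionA x₀ x ∧
      ∀ y : ℝ → EuclideanSpace ℝ (Fin N), IsSolutionA x₀ y → EqOn y x (Ici 0) := by
  obtain ⟨x, hx⟩ := exists_isSolutionA hx₀
  exact ⟨x, hx, fun y hy => hy.eqOn hx⟩
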